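/- An involution on a (not necessarily unital) ring $R$ is an additive map $x\mapsto x^*$ with $(xy)^*=y^*x^*$ and $(x^*)^*=x$. It is *positive definite* if for every positive integer $n$ and all $x_1,\dots,x_n\in R$, $x_1^*x_1+\dots+x_n^*x_n=0$ implies $x_1=\dots=x_n=0$. A projection is an element $p\in R$ with $p=p^*=p^2$, and $R$ is *$*$-regular* if every principal right ideal is generated by a projection: for every $a\in R$ there is a projection $p\in R$ with $aR=pR$. A (directed) graph $E=(E^0,E^1,r,s)$ consists of a set $E^0$ of vertices and a set $E^1$ of edges, of arbitrary cardinalities, and maps $r,s:E^1\to E^0$. A cycle in $E$ is a sequence of edges $e_1\cdots e_n$, $n\ge 1$, with $r(e_i)=s(e_{i+1})$ for $1\le i<n$, $r(e_n)=s(e_1)$, and $s(e_i)\ne s(e_j)$ for $i\neq j$; $E$ is *acyclic* if it contains no cycles. For a field $K$, the Leavitt path algebra $L_K(E)$ is the (associative, not necessarily unital) $K$-algebra generated by the set $E^0\cup E^1\cup\{e^*\mid e\in E^1\}$ subject to the relations (V) $vw=\delta_{v,w}v$ for all $v,w\in E^0$; (P1) $s(e)e=er(e)=e$ for all $e\in E^1$;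 (P2) $r(e)e^*=e^*s(e)=e^*$ for all $e\in E^1$; (CK1) $e^*f=\delta_{e,f}r(e)$ for all $e,f\in E^1$; (CK2) $v=\sum_{e\in s^{-1}(v)}ee^*$ for every $v\in E^0$ for which $s^{-1}(v)$ is finite and nonempty. If $K$ carries an involution $k\mapsto\overline{k}$, then $L_K(E)$ carries the induced involution: the one that satisfies $(kx)^*=\overline{k}x^*$ for $k\in K$, $x\in L_K(E)$, fixes every vertex, and exchanges $e$ and $e^*$ for every edge $e$. **Corollary 3.4.** Let $K$ be a field with an involution. The following conditions are equivalent: (i) the involution on $K$ is positive definite; (ii) for every acyclic graph $E$, the Leavitt path algebra $L_K(E)$, with the induced involution, is $*$-regular. -/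

import Mathlib

universe u v w

/-- A (directed) graph `E = (E⁰, E¹, r, s)`: two sets of arbitrary cardinality with two maps. -/
structure DirectedGraph where
  /-- the set `E⁰` of vertices -/
  Vertex : Type u
  /-- the set `E¹` of edges -/
  Edge : Type v
  /-- the source map -/
  s : Edge → Vertex
  /-- the range map -/
  r : Edge → Vertex

namespace DirectedGraph

/-- A cycle: a path `e₁ … eₙ` of length `n ≥ 1`, so `r(eᵢ) = s(eᵢ₊₁)`, which is closed,
`s(e₁) = r(eₙ)`, and whose edges have pairwise distinct sources. -/
def IsCycle (E : DirectedGraph.{u, v}) (p : List E.Edge) : Prop :=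
  p.IsChain (fun e f => E.r e = E.s f) ∧
    (∃ h : p ≠ [], E.s (p.head h) = E.r (p.getLast h)) ∧
    (p.map E.s).Nodup

/-- A graph is acyclic if it contains no cycles. -/
def Acyclic (E : DirectedGraph.{u, v}) : Prop :=
  ∀ p : List E.Edge, ¬ E.IsCycle p

end DirectedGraph

/-- The generators `E⁰ ∪ E¹ ∪ {e* ∣ e ∈ E¹}` (a disjoint union) of the Leavitt path algebra. -/
inductive LeavittGen (E : DirectedGraph.{u, v}) : Type (max u v)
  | vertex (v : E.Vertex) : LeavittGen E
  | edge (e : E.Edge) : LeavittGen E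
  | ghost (e : E.Edge) : LeavittGen E

/-- The adjoint of a generator: `v* = v`, `(e)* = e*`, `(e*)* = e`. -/
def LeavittGen.adj {E : DirectedGraph.{u, v}} : LeavittGen E → LeavittGen E
  | .vertex v => .vertex v
  | .edge e => .ghost e
  | .ghost e => .edge e

/-- The free (associative, not necessarily unital) `K`-algebra on the generators: the semigroup
algebra of the free semigroup of nonempty words. -/
abbrev FreeLeavitt (K : Type w) [Field K] (E : DirectedGraph.{u, v}) : Type (max u v w) :=
  MonoidAlgebra K (FreeSemigroup (LeavittGen E))

namespace FreeLeavitt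

variable (K : Type w) [Field K] (E : DirectedGraph.{u, v})

/-- A generator as an element of the free algebra. -/
noncomputable def gen (g : LeavittGen E) : FreeLeavitt K E :=
  MonoidAlgebra.single (FreeSemigroup.of g) 1

/-- The defining relations of the Leavitt path algebra. -/
inductive Rel : FreeLeavitt K E → FreeLeavitt K E → Prop
  /-- (V), equal vertices -/
  | vertex_mul_self (v : E.Vertex) :
      Rel (gen K E (.vertex v) * gen K E (.vertex v)) (gen K E (.vertex v))
  /-- (V), distinct vertices -/
  | vertex_mul_of_ne (v w : E.Vertex) (h : v ≠ w) :
      Rel (gen K E (.vertex v) * gen K E (.vertex w)) 0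
  /-- (P1), source -/
  | source_mul_edge (e : E.Edge) :
      Rel (gen K E (.vertex (E.s e)) * gen K E (.edge e)) (gen K E (.edge e))
  /-- (P1), range -/
  | edge_mul_range (e : E.Edge) :
      Rel (gen K E (.edge e) * gen K E (.vertex (E.r e))) (gen K E (.edge e))
  /-- (P2), range -/
  | range_mul_ghost (e : E.Edge) :
      Rel (gen K E (.vertex (E.r e)) * gen K E (.ghost e)) (gen K E (.ghost e))
  /-- (P2), source -/
  | ghost_mul_source (e : E.Edge) :
      Rel (gen K E (.ghost e) * gen K E (.vertex (E.s e))) (gen K E (.ghost e))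
  /-- (CK1), equal edges -/
  | ghost_mul_edge_self (e : E.Edge) :
      Rel (gen K E (.ghost e) * gen K E (.edge e)) (gen K E (.vertex (E.r e)))
  /-- (CK1), distinct edges -/
  | ghost_mul_edge_of_ne (e f : E.Edge) (h : e ≠ f) :
      Rel (gen K E (.ghost e) * gen K E (.edge f)) 0
  /-- (CK2), for every vertex that is neither a sink nor an infinite emitter -/
  | vertex_eq_sum (v : E.Vertex) (hfin : {e : E.Edge | E.s e = v}.Finite)
      (hne : {e : E.Edge | E.s e = v}.Nonempty) :
      Rel (gen K E (.vertex v)) (∑ e ∈ hfin.toFinset, gen K E (.edge e) * gen K E (.ghost e))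

/-- The congruence of `K`-algebras generated by the defining relations. Scalar multiples of the
relations are imposed too, as a ring congruence of a ring without identity need not be
compatible with scalars. -/
noncomputable def con : RingCon (FreeLeavitt K E) :=
  ringConGen fun x y => ∃ (k : K) (a b : FreeLeavitt K E), Rel K E a b ∧ x = k • a ∧ y = k • b

variable {K E}

theorem con_of_rel {a b : FreeLeavitt K E} (h : Rel K E a b) : con K E a b :=
  RingConGen.Rel.of _ _ ⟨1, a, b, h, (one_smul _ _).symm, (one_smul _ _).symm⟩

theorem con_smul (k : K) {x y : FreeLeavitt K E} (h : con K E x y) :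
    con K E (k • x) (k • y) := by
  change RingConGen.Rel _ x y at h
  change RingConGen.Rel _ _ _
  induction h with
  | of x y h =>
    obtain ⟨k', a, b, h, rfl, rfl⟩ := h
    exact .of _ _ ⟨k * k', a, b, h, smul_smul _ _ _, smul_smul _ _ _⟩
  | refl x => exact .refl _
  | symm _ ih => exact ih.symm
  | trans _ _ ih₁ ih₂ => exact ih₁.trans ih₂
  | add _ _ ih₁ ih₂ => simpa only [smul_add] using ih₁.add ih₂
  | mul _ h₂ ih₁ _ => simpa only [smul_mul_assoc] using ih₁.mul h₂

/-- The adjoint of a word: `(g₁ g₂ … gₙ)* = gₙ* … g₂* g₁*`. -/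
def wordAdj (x : FreeSemigroup (LeavittGen E)) : FreeSemigroup (LeavittGen E) :=
  (FreeSemigroup.lift (fun g : LeavittGen E => MulOpposite.op (FreeSemigroup.of g.adj)) x).unop

theorem wordAdj_of (g : LeavittGen E) :
    wordAdj (FreeSemigroup.of g) = FreeSemigroup.of g.adj := rfl

theorem wordAdj_mul (x y : FreeSemigroup (LeavittGen E)) :
    wordAdj (x * y) = wordAdj y * wordAdj x := by
  simp [wordAdj]

theorem wordAdj_wordAdj (x : FreeSemigroup (LeavittGen E)) : wordAdj (wordAdj x) = x := by
  induction x using FreeSemigroup.recOnMul with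
  | ih1 g => cases g <;> rfl
  | ih2 g y ih₁ ih₂ => rw [wordAdj_mul, wordAdj_mul, ih₁, ih₂]

variable [StarRing K]

/-- The conjugate-linear map of the free algebra that sends each word to its adjoint. -/
noncomputable def adj : FreeLeavitt K E →+ FreeLeavitt K E :=
  (Finsupp.liftAddHom fun x : FreeSemigroup (LeavittGen E) =>
    (MonoidAlgebra.singleAddHom (wordAdj x)).comp
      (starAddEquiv : K ≃+ K).toAddMonoidHom).comp
    (MonoidAlgebra.coeffAddEquiv (R := K) (M := FreeSemigroup (LeavittGen E))).toAddMonoidHom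

theorem adj_single (x : FreeSemigroup (LeavittGen E)) (k : K) :
    adj (MonoidAlgebra.single x k : FreeLeavitt K E) =
      MonoidAlgebra.single (wordAdj x) (star k) := by
  simp [adj]

theorem adj_gen (g : LeavittGen E) : adj (gen K E g) = gen K E g.adj := by
  simp [gen, adj_single, wordAdj_of]

theorem adj_adj (x : FreeLeavitt K E) : adj (adj x) = x := by
  have : (adj.comp adj : FreeLeavitt K E →+ FreeLeavitt K E) = AddMonoidHom.id _ :=
    MonoidAlgebra.addMonoidHom_ext fun w k => by
      simp [adj_single, wordAdj_wordAdj]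
  exact DFunLike.congr_fun this x

theorem adj_mul (x y : FreeLeavitt K E) : adj (x * y) = adj y * adj x := by
  have : (adj.comp (AddMonoidHom.mulLeft x)) = (AddMonoidHom.mulRight (adj x)).comp adj := by
    refine MonoidAlgebra.addMonoidHom_ext fun w k => ?_
    have : (adj.comp (AddMonoidHom.mulRight (MonoidAlgebra.single w k : FreeLeavitt K E))) =
        (AddMonoidHom.mulLeft (adj (MonoidAlgebra.single w k : FreeLeavitt K E))).comp adj :=
      MonoidAlgebra.addMonoidHom_ext fun w' k' => by
        simp [adj_single, wordAdj_mul, MonoidAlgebra.single_mul_single, mul_comm]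
    exact DFunLike.congr_fun this x
  exact DFunLike.congr_fun this y

theorem adj_smul (k : K) (x : FreeLeavitt K E) : adj (k • x) = star k • adj x := by
  have : (adj.comp (DistribSMul.toAddMonoidHom _ k) : FreeLeavitt K E →+ FreeLeavitt K E) =
      (DistribSMul.toAddMonoidHom _ (star k)).comp adj :=
    MonoidAlgebra.addMonoidHom_ext fun w k => by
      simp [adj_single]
  exact DFunLike.congr_fun this x

theorem con_adj_of_rel {a b : FreeLeavitt K E} (h : Rel K E a b) : con K E (adj a) (adj b) := by
  cases h with
  | vertex_mul_self v =>
    simpa only [adj_mul, adj_gen, LeavittGen.adj] using con_of_rel (.vertex_mul_self v)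
  | vertex_mul_of_ne v w h =>
    simpa only [adj_mul, adj_gen, LeavittGen.adj, map_zero] using con_of_rel (.vertex_mul_of_ne w v h.symm)
  | source_mul_edge e =>
    simpa only [adj_mul, adj_gen, LeavittGen.adj] using con_of_rel (.ghost_mul_source e)
  | edge_mul_range e =>
    simpa only [adj_mul, adj_gen, LeavittGen.adj] using con_of_rel (.range_mul_ghost e)
  | range_mul_ghost e =>
    simpa only [adj_mul, adj_gen, LeavittGen.adj] using con_of_rel (.edge_mul_range e)
  | ghost_mul_source e =>
    simpa only [adj_mul, adj_gen, LeavittGen.adj] using con_of_rel (.source_mul_edge e)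
  | ghost_mul_edge_self e =>
    simpa only [adj_mul, adj_gen, LeavittGen.adj] using con_of_rel (.ghost_mul_edge_self e)
  | ghost_mul_edge_of_ne e f h =>
    simpa only [adj_mul, adj_gen, LeavittGen.adj, map_zero] using con_of_rel (.ghost_mul_edge_of_ne f e h.symm)
  | vertex_eq_sum v hfin hne =>
    simpa only [adj_mul, adj_gen, LeavittGen.adj, map_sum] using con_of_rel (.vertex_eq_sum v hfin hne)

theorem con_adj {x y : FreeLeavitt K E} (h : con K E x y) : con K E (adj x) (adj y) := by
  change RingConGen.Rel _ x y at h
  induction h with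
  | of x y h =>
    obtain ⟨k, a, b, h, rfl, rfl⟩ := h
    rw [adj_smul, adj_smul]
    exact con_smul _ (con_adj_of_rel h)
  | refl x => exact (con K E).refl _
  | symm _ ih => exact (con K E).symm ih
  | trans _ _ ih₁ ih₂ => exact (con K E).trans ih₁ ih₂
  | add _ _ ih₁ ih₂ => simpa only [map_add] using (con K E).add ih₁ ih₂
  | mul _ _ ih₁ ih₂ => simpa only [adj_mul] using (con K E).mul ih₂ ih₁

end FreeLeavitt

/-- The Leavitt path algebra `L_K(E)`: the (not necessarily unital) `K`-algebra generated by
`E⁰ ∪ E¹ ∪ {e* ∣ e ∈ E¹}` subject to (V), (P1), (P2), (CK1), (CK2). -/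
def LeavittPathAlgebra (K : Type w) [Field K] (E : DirectedGraph.{u, v}) : Type (max u v w) :=
  (FreeLeavitt.con K E).Quotient

namespace LeavittPathAlgebra

variable {K : Type w} [Field K] {E : DirectedGraph.{u, v}}

noncomputable instance : NonUnitalRing (LeavittPathAlgebra K E) :=
  inferInstanceAs (NonUnitalRing (FreeLeavitt.con K E).Quotient)

/-- The quotient map from the free algebra. -/
noncomputable def mk (x : FreeLeavitt K E) : LeavittPathAlgebra K E := RingCon.toQuotient x

theorem mk_surjective : Function.Surjective (mk : FreeLeavitt K E → LeavittPathAlgebra K E) :=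
  Quotient.mk''_surjective

theorem mk_eq_mk {x y : FreeLeavitt K E} : mk x = mk y ↔ FreeLeavitt.con K E x y :=
  RingCon.eq _

theorem mk_zero : (mk 0 : LeavittPathAlgebra K E) = 0 := rfl

theorem mk_add (x y : FreeLeavitt K E) : mk (x + y) = mk x + mk y := rfl

theorem mk_mul (x y : FreeLeavitt K E) : mk (x * y) = mk x * mk y := rfl

noncomputable instance : SMul K (LeavittPathAlgebra K E) where
  smul k := Quotient.map' (k • ·) fun _ _ h => FreeLeavitt.con_smul k h

theorem mk_smul (k : K) (x : FreeLeavitt K E) : mk (k • x) = k • mk x := rfl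

noncomputable instance : Module K (LeavittPathAlgebra K E) :=
  Function.Surjective.module K (⟨⟨mk, mk_zero⟩, mk_add⟩ : FreeLeavitt K E →+ _)
    mk_surjective mk_smul

instance : IsScalarTower K (LeavittPathAlgebra K E) (LeavittPathAlgebra K E) where
  smul_assoc k x y := by
    obtain ⟨x, rfl⟩ := mk_surjective x
    obtain ⟨y, rfl⟩ := mk_surjective y
    simp only [smul_eq_mul, ← mk_smul, ← mk_mul, smul_mul_assoc]

instance : SMulCommClass K (LeavittPathAlgebra K E) (LeavittPathAlgebra K E) where
  smul_comm k x y := by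
    obtain ⟨x, rfl⟩ := mk_surjective x
    obtain ⟨y, rfl⟩ := mk_surjective y
    simp only [smul_eq_mul, ← mk_smul, ← mk_mul, mul_smul_comm]

/-- The image in `L_K(E)` of a generator. -/
noncomputable def gen (K : Type w) [Field K] {E : DirectedGraph.{u, v}} (g : LeavittGen E) :
    LeavittPathAlgebra K E :=
  mk (FreeLeavitt.gen K E g)

variable [StarRing K]

/-- The involution of `L_K(E)` induced by the involution of `K`: the conjugate-linear
anti-multiplicative map that fixes the vertices and exchanges `e` and `e*`; hence it sends
`∑ kᵢ pᵢ qᵢ*` to `∑ star kᵢ • qᵢ pᵢ*`. -/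
noncomputable instance : StarRing (LeavittPathAlgebra K E) where
  star := Quotient.map' FreeLeavitt.adj fun _ _ h => FreeLeavitt.con_adj h
  star_involutive x := by
    obtain ⟨x, rfl⟩ := mk_surjective x
    exact congrArg mk (FreeLeavitt.adj_adj x)
  star_mul x y := by
    obtain ⟨x, rfl⟩ := mk_surjective x
    obtain ⟨y, rfl⟩ := mk_surjective y
    exact congrArg mk (FreeLeavitt.adj_mul x y)
  star_add x y := by
    obtain ⟨x, rfl⟩ := mk_surjective x
    obtain ⟨y, rfl⟩ := mk_surjective y
    exact congrArg mk (map_add FreeLeavitt.adj x y)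

theorem star_mk (x : FreeLeavitt K E) : star (mk x) = mk (FreeLeavitt.adj x) := rfl

theorem star_gen (g : LeavittGen E) : star (gen K g) = gen K g.adj :=
  congrArg mk (FreeLeavitt.adj_gen g)

instance : StarModule K (LeavittPathAlgebra K E) where
  star_smul k x := by
    obtain ⟨x, rfl⟩ := mk_surjective x
    exact congrArg mk (FreeLeavitt.adj_smul k x)

end LeavittPathAlgebra

/-- The involution of a `*`-ring is `n`-proper: `x₁* x₁ + ⋯ + xₙ* xₙ = 0` only if
`x₁ = ⋯ = xₙ = 0`. -/
def IsNProper (R : Type w) [NonUnitalRing R] [StarRing R] (n : ℕ) : Prop :=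
  ∀ x : Fin n → R, ∑ i, star (x i) * x i = 0 → ∀ i, x i = 0

/-- The involution of a `*`-ring is positive definite: `n`-proper for every positive `n`. -/
def IsPosDefInvolution (R : Type w) [NonUnitalRing R] [StarRing R] : Prop :=
  ∀ n : ℕ, 0 < n → IsNProper R n

/-- A `*`-ring (with local units) is `*`-regular: every principal right ideal `aR` is generated
by a projection, `aR = pR` with `p = p* = p²`. -/
def IsStarRegular (R : Type w) [NonUnitalRing R] [StarRing R] : Prop :=
  ∀ a : R, ∃ p : R, IsStarProjection p ∧
    Set.range (fun x : R => a * x) = Set.range (fun x : R => p * x)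

/-!
(i) ⇒ (ii). If `E` is acyclic, every element of `L_K(E)` lies in a finite-dimensional subalgebra, so
`*`-regularity follows once `a* a = 0` forces `a = 0`. This is proved by induction on the length of
the ghost parts of the monomials of `a`. Multiplying `a` on the right by an edge `e` shortens them
and preserves the hypothesis, so `a e = 0` for every `e`; in the acyclic case this makes each `a v`
a combination `∑ kᵢ pᵢ` of paths with range `v`. No such path extends another, so
`(a v)* (a v) = (∑ kᵢ* kᵢ) v`, and positive definiteness on `K` applies.

(ii) ⇒ (i). For parallel edges `e₁, …, eₙ` with range `v` and `a = ∑ kᵢ eᵢ`, again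
`a* a = (∑ kᵢ* kᵢ) v`, while `*`-regularity makes `a* a = 0` imply `a = 0`.

Both directions need that vertices do not vanish in the quotient, which is seen from the action of
`L_K(E)` on the functions on maximal paths.
-/

section StarRegular

variable {R : Type*} [NonUnitalRing R] [StarRing R]

theorem isNProper_one_iff : IsNProper R 1 ↔ ∀ x : R, star x * x = 0 → x = 0 := by
  simp only [IsNProper, Fin.sum_univ_one, Fin.forall_fin_one]
  exact ⟨fun h x => h fun _ => x, fun h x => h (x 0)⟩

theorem IsStarRegular.isNProper_one (hR : IsStarRegular R) (hunit : ∀ a : R, ∃ u, a * u = a) :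
    IsNProper R 1 := by
  refine isNProper_one_iff.mpr fun x hx => ?_
  obtain ⟨p, proj, range_eq⟩ := hR x
  obtain ⟨u, hu⟩ := hunit x
  obtain ⟨y, hy : p * y = x⟩ := range_eq.le ⟨u, hu⟩
  obtain ⟨z, hz : x * z = p⟩ := range_eq.ge ⟨p, proj.isIdempotentElem⟩
  have proj_mul : p * x = x := by rw [← hy, ← mul_assoc, proj.isIdempotentElem.eq]
  rw [← proj_mul, ← proj.isSelfAdjoint.star_eq, ← hz, star_mul, mul_assoc, hx, mul_zero]

theorem star_mul_mul_mul_eq_zero {a : R} (ha : star a * a = 0) (b : R) :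
    star (a * b) * (a * b) = 0 := by
  rw [star_mul, mul_assoc, ← mul_assoc (star a), ha, zero_mul, mul_zero]

theorem IsNProper.mul_eq_zero_of_star_mul_mul_eq_zero (hR : IsNProper R 1) {a x : R}
    (h : star a * (a * x) = 0) : a * x = 0 :=
  isNProper_one_iff.mp hR _ (by rw [star_mul, mul_assoc, h, mul_zero])

theorem isStarProjection_mul_of_isSelfAdjoint {S : Type*} [Semigroup S] [StarMul S] {h y : S}
    (hh : IsSelfAdjoint h) (hy : h * (h * y) = h) : IsStarProjection (h * y) := by
  have star_mul_self : star (h * y) * (h * y) = h * y := by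
    rw [← mul_assoc]
    congr 1
    simpa only [star_mul, hh.star_eq] using congrArg star hy
  have self_adjoint : star (h * y) = h * y := by
    rw [← star_mul_self, star_mul, star_star]
  exact ⟨by rwa [self_adjoint] at star_mul_self, self_adjoint⟩

theorem range_comp_self_eq_range_of_ker_comp_self_le {K V : Type*} [DivisionRing K]
    [AddCommGroup V] [Module K V] [FiniteDimensional K V] {T : V →ₗ[K] V}
    (h : LinearMap.ker (T ∘ₗ T) ≤ LinearMap.ker T) :
    LinearMap.range (T ∘ₗ T) = LinearMap.range T := by
  have ker_eq : LinearMap.ker (T ∘ₗ T) = LinearMap.ker T :=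
    le_antisymm h (LinearMap.ker_le_ker_comp T T)
  refine Submodule.eq_of_le_of_finrank_eq (LinearMap.range_comp_le_range T T) ?_
  have rank_comp := (T ∘ₗ T).finrank_range_add_finrank_ker
  rw [ker_eq, ← T.finrank_range_add_finrank_ker] at rank_comp
  exact Nat.add_right_cancel rank_comp

variable {K : Type*} [Field K] [Module K R] [SMulCommClass K R R]

/-- The hypothesis makes left multiplication by `h` injective on its range, hence onto it. -/
theorem IsNProper.exists_mul_mul_eq_self (hR : IsNProper R 1) {h : R} (hh : IsSelfAdjoint h)
    (A : NonUnitalSubalgebra K R) [FiniteDimensional K A] (hA : h ∈ A) :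
    ∃ y, h * (h * y) = h := by
  have cancel {x : R} (hx : h * (h * x) = 0) : h * x = 0 :=
    hR.mul_eq_zero_of_star_mul_mul_eq_zero (by rwa [hh.star_eq])
  let T : A →ₗ[K] A := LinearMap.mulLeft K ⟨h, hA⟩
  have range_eq : LinearMap.range (T ∘ₗ T) = LinearMap.range T :=
    range_comp_self_eq_range_of_ker_comp_self_le fun x hx =>
      Subtype.ext (cancel (congrArg Subtype.val hx))
  have exists_square (x : A) : ∃ y : A, h * (h * y) = h * x := by
    obtain ⟨y, hy⟩ := range_eq.ge (LinearMap.mem_range_self T x)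
    exact ⟨y, congrArg Subtype.val hy⟩
  obtain ⟨y, hy⟩ := exists_square ⟨h, hA⟩
  have hy' : h * y = h := by
    have h0 : h * (h * y - h) = 0 := by rw [mul_sub, hy, sub_self]
    refine sub_eq_zero.mp (isNProper_one_iff.mp hR _ ?_)
    rw [star_sub, star_mul, hh.star_eq, sub_mul, mul_assoc, h0, mul_zero, sub_zero]
  obtain ⟨z, hz⟩ := exists_square y
  exact ⟨z, hz.trans hy'⟩

theorem IsNProper.isStarRegular_of_locallyFinite (hR : IsNProper R 1)
    (hfin : ∀ a : R, ∃ A : NonUnitalSubalgebra K R, FiniteDimensional K A ∧ a ∈ A) :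
    IsStarRegular R := by
  intro a
  obtain ⟨A, _, hA⟩ := hfin (a * star a)
  have hh : IsSelfAdjoint (a * star a) := .mul_star_self a
  obtain ⟨y, hy⟩ := hR.exists_mul_mul_eq_self hh A hA
  have proj : IsStarProjection (a * star a * y) := isStarProjection_mul_of_isSelfAdjoint hh hy
  set p := a * star a * y with hp
  have star_mul_proj : star a * p = star a := by
    have h0 : a * (star a * p - star a) = 0 := by rw [mul_sub, ← mul_assoc, hy, sub_self]
    refine sub_eq_zero.mp (isNProper_one_iff.mp hR _ ?_)
    rw [star_sub, star_mul, star_star, proj.isSelfAdjoint.star_eq, sub_mul, mul_assoc, h0,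
      mul_zero, sub_zero]
  have proj_mul : p * a = a := by
    simpa only [star_mul, star_star, proj.isSelfAdjoint.star_eq] using congrArg star star_mul_proj
  refine ⟨p, proj, Set.Subset.antisymm ?_ ?_⟩
  · rintro _ ⟨x, rfl⟩
    exact ⟨a * x, by simp only [← mul_assoc, proj_mul]⟩
  · rintro _ ⟨x, rfl⟩
    exact ⟨star a * y * x, by simp only [hp, mul_assoc]⟩

end StarRegular

section OrthonormalFamily

/-- The relations `uᵢ* uᵢ = v` and `uᵢ* uⱼ = 0` for `i ≠ j`. In a Leavitt path algebra they hold
for paths none of which extends another, all with the same range `v`. -/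
def IsOrthonormalFamily {A ι : Type*} [Mul A] [Zero A] [Star A] (v : A) (u : ι → A) : Prop :=
  (∀ i, star (u i) * u i = v) ∧ Pairwise fun i j => star (u i) * u j = 0

theorem IsPosDefInvolution.eq_zero_of_sum_star_mul_self {K ι : Type*} [NonUnitalRing K]
    [StarRing K] (hK : IsPosDefInvolution K) {s : Finset ι} {f : ι → K}
    (h : ∑ i ∈ s, star (f i) * f i = 0) {i : ι} (hi : i ∈ s) : f i = 0 := by
  rw [← s.sum_coe_sort, ← s.equivFin.symm.sum_comp] at h
  simpa using hK _ (Finset.card_pos.mpr ⟨i, hi⟩) _ h (s.equivFin ⟨i, hi⟩)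

variable {K A ι : Type*} [Field K] [NonUnitalRing A] [StarRing A] [Module K A]
  [SMulCommClass K A A] {v : A} {u : ι → A}

theorem IsOrthonormalFamily.star_mul_linearCombination (hu : IsOrthonormalFamily v u) (j : ι)
    (l : ι →₀ K) : star (u j) * Finsupp.linearCombination K u l = l j • v := by
  rw [Finsupp.linearCombination_apply, Finsupp.mul_sum, Finsupp.sum_eq_single j]
  · rw [mul_smul_comm, hu.1]
  · intro i _ hij
    rw [mul_smul_comm, hu.2 hij.symm, smul_zero]
  · intro _
    rw [zero_smul, mul_zero]

variable [IsScalarTower K A A]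

theorem IsOrthonormalFamily.eq_zero_of_mul_eq_zero (hu : IsOrthonormalFamily v u) {a b : A}
    (ha : a ∈ Submodule.span K (Set.range u)) (hb : v * b ≠ 0) (hab : a * b = 0) : a = 0 := by
  rw [← Finsupp.range_linearCombination] at ha
  obtain ⟨l, rfl⟩ := ha
  suffices l = 0 by rw [this, map_zero]
  ext j
  have coeff_smul : l j • (v * b) = 0 := by
    rw [← smul_mul_assoc, ← hu.star_mul_linearCombination, mul_assoc, hab, mul_zero]
  exact (smul_eq_zero.mp coeff_smul).resolve_right hb

variable [StarRing K] [StarModule K A]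

theorem IsOrthonormalFamily.star_linearCombination_mul_self (hu : IsOrthonormalFamily v u)
    (l : ι →₀ K) :
    star (Finsupp.linearCombination K u l) * Finsupp.linearCombination K u l =
      (l.sum fun _ c => star c * c) • v := by
  conv_lhs => enter [1, 1]; rw [Finsupp.linearCombination_apply, Finsupp.sum]
  simp only [star_sum, star_smul, Finset.sum_mul, smul_mul_assoc, hu.star_mul_linearCombination,
    smul_smul, Finsupp.sum, Finset.sum_smul]

theorem IsOrthonormalFamily.eq_zero_of_star_mul_self_eq_zero (hu : IsOrthonormalFamily v u)
    (hK : IsPosDefInvolution K) (hv : v ≠ 0) {a : A}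
    (ha : a ∈ Submodule.span K (Set.range u)) (h : star a * a = 0) : a = 0 := by
  rw [← Finsupp.range_linearCombination] at ha
  obtain ⟨l, rfl⟩ := ha
  rw [hu.star_linearCombination_mul_self, smul_eq_zero, or_iff_left hv] at h
  suffices l = 0 by rw [this, map_zero]
  by_contra hl
  obtain ⟨i, hi⟩ := Finsupp.support_nonempty_iff.mpr hl
  exact Finsupp.mem_support_iff.mp hi (hK.eq_zero_of_sum_star_mul_self h hi)

theorem IsOrthonormalFamily.isNProper {n : ℕ} {u : Fin n → A} (hu : IsOrthonormalFamily v u)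
    (hv : v ≠ 0) (hA : IsNProper A 1) : IsNProper K n := by
  intro x hx i
  let l : Fin n →₀ K := Finsupp.equivFunOnFinite.symm x
  have comb_eq_zero : Finsupp.linearCombination K u l = 0 := by
    refine isNProper_one_iff.mp hA _ ?_
    rw [hu.star_linearCombination_mul_self, Finsupp.sum_fintype _ _ fun _ => by simp]
    exact (congrArg (· • v) hx).trans (zero_smul K v)
  have coeff_smul : l i • v = 0 := by
    rw [← hu.star_mul_linearCombination, comb_eq_zero, mul_zero]
  exact (smul_eq_zero.mp coeff_smul).resolve_right hv

end OrthonormalFamily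

theorem finite_setOf_nodup_forall_mem {α : Type*} {s : Set α} (hs : s.Finite) :
    {l : List α | l.Nodup ∧ ∀ a ∈ l, a ∈ s}.Finite := by
  classical
  have := hs.fintype
  refine (Set.finite_range fun l : {l : List s // l.Nodup} => l.1.map Subtype.val).subset ?_
  rintro l ⟨hl, hls⟩
  lift l to List s using hls
  exact ⟨⟨l, hl.of_map _⟩, rfl⟩

namespace DirectedGraph

variable {E : DirectedGraph.{u, v}} {p q : List E.Edge} {e : E.Edge} {x : E.Vertex}

/-- The source of the path with edges `p` and range `x`; the range has to be given because of the
empty path, which has source `x`. -/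
def src (E : DirectedGraph.{u, v}) (p : List E.Edge) (x : E.Vertex) : E.Vertex :=
  (p.map E.s).headD x

/-- The edges `p` form a path with range `x`. -/
def IsPath (E : DirectedGraph.{u, v}) (p : List E.Edge) (x : E.Vertex) : Prop :=
  p.IsChain (fun e f => E.r e = E.s f) ∧ ∀ e ∈ p.getLast?, E.r e = x

theorem isPath_nil : E.IsPath [] x := by
  simp [IsPath]

theorem isPath_cons : E.IsPath (e :: p) x ↔ E.r e = E.src p x ∧ E.IsPath p x := by
  cases p <;> simp [IsPath, src, List.getLast?_cons_cons, and_assoc]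

theorem IsPath.of_append (h : E.IsPath (p ++ e :: q) x) : E.IsPath p (E.s e) := by
  obtain ⟨hp, -, hpe⟩ := List.isChain_append.mp h.1
  exact ⟨hp, fun f hf => hpe f hf e rfl⟩

theorem IsPath.isCycle (h : E.IsPath (e :: p) (E.s e)) (hn : ((e :: p).map E.s).Nodup) :
    E.IsCycle (e :: p) :=
  ⟨h.1, ⟨List.cons_ne_nil e p, (h.2 _ (List.getLast?_eq_some_getLast _)).symm⟩, hn⟩

theorem Acyclic.nodup_map_source (hE : E.Acyclic) (h : E.IsPath p x) : (p.map E.s).Nodup := by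
  induction p with
  | nil => exact List.nodup_nil
  | cons e p ih =>
    have hp := ih (isPath_cons.mp h).2
    refine List.nodup_cons.mpr ⟨fun hmem => ?_, hp⟩
    obtain ⟨f, hf, hfe⟩ := List.mem_map.mp hmem
    obtain ⟨p₁, p₂, rfl⟩ := List.append_of_mem hf
    have closed : E.IsPath (e :: p₁) (E.s e) := hfe ▸ IsPath.of_append (p := e :: p₁) h
    rw [List.map_append, List.map_cons, hfe] at hp
    exact hE _ (closed.isCycle ((List.nodup_middle.mp hp).sublist (by simp)))

theorem Acyclic.source_ne (hE : E.Acyclic) (h : E.IsPath (e :: p) x) : E.s e ≠ x := by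
  rintro rfl
  exact hE _ (h.isCycle (hE.nodup_map_source h))

theorem Acyclic.finite_setOf_isPath (hE : E.Acyclic) {F : Set E.Edge} (hF : F.Finite)
    (x : E.Vertex) : {p | E.IsPath p x ∧ ∀ e ∈ p, e ∈ F}.Finite :=
  (finite_setOf_nodup_forall_mem hF).subset fun _ hp =>
    ⟨(hE.nodup_map_source hp.1).of_map _, hp.2⟩

end DirectedGraph

namespace LeavittPathAlgebra

variable {K : Type w} [Field K] {E : DirectedGraph.{u, v}} {e f : E.Edge} {x y : E.Vertex}
  {p q r : List E.Edge}

theorem mk_eq_mk_of_rel {a b : FreeLeavitt K E} (h : FreeLeavitt.Rel K E a b) :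
    (mk a : LeavittPathAlgebra K E) = mk b :=
  mk_eq_mk.mpr (FreeLeavitt.con_of_rel h)

theorem mk_sum {ι : Type*} (s : Finset ι) (f : ι → FreeLeavitt K E) :
    (mk (∑ i ∈ s, f i) : LeavittPathAlgebra K E) = ∑ i ∈ s, mk (f i) :=
  map_sum (⟨⟨mk, mk_zero⟩, mk_add⟩ : FreeLeavitt K E →+ LeavittPathAlgebra K E) f s

variable (K) in
/-- A vertex as an element of the Leavitt path algebra. -/
noncomputable abbrev vert (x : E.Vertex) : LeavittPathAlgebra K E := gen K (.vertex x)

variable (K) in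
/-- An edge `e` as an element of the Leavitt path algebra. -/
noncomputable abbrev edge (e : E.Edge) : LeavittPathAlgebra K E := gen K (.edge e)

variable (K) in
/-- The ghost edge `e*` as an element of the Leavitt path algebra. -/
noncomputable abbrev ghost (e : E.Edge) : LeavittPathAlgebra K E := gen K (.ghost e)

theorem vert_mul_self (x : E.Vertex) : vert K x * vert K x = vert K x :=
  mk_eq_mk_of_rel (.vertex_mul_self x)

theorem vert_mul_of_ne (h : x ≠ y) : vert K x * vert K y = 0 :=
  mk_eq_mk_of_rel (.vertex_mul_of_ne x y h)

theorem source_mul_edge (e : E.Edge) : vert K (E.s e) * edge K e = edge K e :=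
  mk_eq_mk_of_rel (.source_mul_edge e)

theorem edge_mul_range (e : E.Edge) : edge K e * vert K (E.r e) = edge K e :=
  mk_eq_mk_of_rel (.edge_mul_range e)

theorem range_mul_ghost (e : E.Edge) : vert K (E.r e) * ghost K e = ghost K e :=
  mk_eq_mk_of_rel (.range_mul_ghost e)

theorem ghost_mul_source (e : E.Edge) : ghost K e * vert K (E.s e) = ghost K e :=
  mk_eq_mk_of_rel (.ghost_mul_source e)

theorem ghost_mul_edge_self (e : E.Edge) : ghost K e * edge K e = vert K (E.r e) :=
  mk_eq_mk_of_rel (.ghost_mul_edge_self e)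

theorem ghost_mul_edge_of_ne (h : e ≠ f) : ghost K e * edge K f = 0 :=
  mk_eq_mk_of_rel (.ghost_mul_edge_of_ne e f h)

theorem vert_eq_sum (hfin : {e : E.Edge | E.s e = x}.Finite)
    (hne : {e : E.Edge | E.s e = x}.Nonempty) :
    vert K x = ∑ e ∈ hfin.toFinset, edge K e * ghost K e :=
  (mk_eq_mk_of_rel (.vertex_eq_sum x hfin hne)).trans (mk_sum _ _)

theorem vert_mul_edge_of_ne (h : x ≠ E.s e) : vert K x * edge K e = 0 := by
  rw [← source_mul_edge, ← mul_assoc, vert_mul_of_ne h, zero_mul]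

variable (K) in
/-- The element `e₁ ⋯ eₙ x` of the Leavitt path algebra, which vanishes unless `e₁ ⋯ eₙ` is a path
with range `x`. The factor `x` takes care of the empty path. -/
noncomputable def path : List E.Edge → E.Vertex → LeavittPathAlgebra K E
  | [], x => vert K x
  | e :: p, x => edge K e * path p x

theorem path_nil (x : E.Vertex) : path K [] x = vert K x := rfl

theorem path_cons (e : E.Edge) (p : List E.Edge) (x : E.Vertex) :
    path K (e :: p) x = edge K e * path K p x := rfl

theorem path_singleton (e : E.Edge) : path K [e] (E.r e) = edge K e :=
  edge_mul_range e

theorem src_mul_path (p : List E.Edge) (x : E.Vertex) :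
    vert K (E.src p x) * path K p x = path K p x := by
  cases p with
  | nil => exact vert_mul_self x
  | cons e p => exact (mul_assoc _ _ _).symm.trans (congrArg (· * path K p x) (source_mul_edge e))

theorem vert_mul_path_of_ne (h : y ≠ E.src p x) : vert K y * path K p x = 0 := by
  rw [← src_mul_path, ← mul_assoc, vert_mul_of_ne h, zero_mul]

theorem vert_mul_path_eq_or (y : E.Vertex) (p : List E.Edge) (x : E.Vertex) :
    vert K y * path K p x = path K p x ∨ vert K y * path K p x = 0 := by
  by_cases h : y = E.src p x
  · exact .inl (h ▸ src_mul_path p x)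
  · exact .inr (vert_mul_path_of_ne h)

theorem path_mul_vert (p : List E.Edge) (x : E.Vertex) :
    path K p x * vert K x = path K p x := by
  induction p with
  | nil => exact vert_mul_self x
  | cons e p ih => rw [path_cons, mul_assoc, ih]

theorem path_mul_vert_of_ne (h : x ≠ y) : path K p x * vert K y = 0 := by
  rw [← path_mul_vert, mul_assoc, vert_mul_of_ne h, mul_zero]

theorem path_mul_path_eq_or (p : List E.Edge) (x : E.Vertex) (q : List E.Edge) (y : E.Vertex) :
    path K p x * path K q y = path K (p ++ q) y ∨ path K p x * path K q y = 0 := by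
  induction p with
  | nil => exact vert_mul_path_eq_or x q y
  | cons e p ih =>
    rw [path_cons, mul_assoc]
    exact ih.imp (congrArg (edge K e * ·)) fun h => by rw [h, mul_zero]

theorem path_eq_zero (h : ¬ E.IsPath p x) : path K p x = 0 := by
  induction p with
  | nil => exact absurd DirectedGraph.isPath_nil h
  | cons e p ih =>
    rw [path_cons]
    by_cases hp : E.IsPath p x
    · rw [← edge_mul_range, mul_assoc, vert_mul_path_of_ne, mul_zero]
      exact fun he => h (DirectedGraph.isPath_cons.mpr ⟨he, hp⟩)
    · rw [ih hp, mul_zero]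

theorem mul_sum_vert_of_mul_vert {a : LeavittPathAlgebra K E} (h : a * vert K x = a)
    {T : Finset E.Vertex} (hx : x ∈ T) : a * ∑ y ∈ T, vert K y = a := by
  conv_lhs => rw [← h]
  rw [mul_assoc, Finset.mul_sum, Finset.sum_eq_single_of_mem x hx, vert_mul_self, h]
  exact fun y _ hy => vert_mul_of_ne hy.symm

section Star

variable [StarRing K]

theorem star_vert (x : E.Vertex) : star (vert K x) = vert K x := star_gen _

theorem star_edge (e : E.Edge) : star (edge K e) = ghost K e := star_gen _

theorem star_path_cons (e : E.Edge) (p : List E.Edge) (x : E.Vertex) :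
    star (path K (e :: p) x) = star (path K p x) * ghost K e := by
  rw [path_cons, star_mul, star_edge]

theorem star_path_mul_src (p : List E.Edge) (x : E.Vertex) :
    star (path K p x) * vert K (E.src p x) = star (path K p x) := by
  rw [← star_vert, ← star_mul, src_mul_path]

theorem star_path_mul_vert_eq_or (p : List E.Edge) (x y : E.Vertex) :
    star (path K p x) * vert K y = star (path K p x) ∨ star (path K p x) * vert K y = 0 := by
  rw [← star_vert y, ← star_mul, star_inj, star_eq_zero]
  exact vert_mul_path_eq_or y p x

/-- Two paths cancel against each other until one of them is exhausted or they diverge. -/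
theorem star_path_mul_path_eq_or (p : List E.Edge) (x : E.Vertex) (q : List E.Edge)
    (y : E.Vertex) :
    star (path K p x) * path K q y = 0 ∨
      (∃ r, r <:+ q ∧ star (path K p x) * path K q y = path K r y) ∨
      ∃ r, r <:+ p ∧ star (path K p x) * path K q y = star (path K r x) := by
  induction p generalizing q with
  | nil =>
    rw [path_nil, star_vert]
    rcases vert_mul_path_eq_or (K := K) x q y with h | h
    · exact .inr (.inl ⟨q, List.suffix_rfl, h⟩)
    · exact .inl h
  | cons e p ih =>
    cases q with
    | nil =>
      rcases star_path_mul_vert_eq_or (K := K) (e :: p) x y with h | h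
      · exact .inr (.inr ⟨e :: p, List.suffix_rfl, h⟩)
      · exact .inl h
    | cons f q =>
      rw [star_path_cons, path_cons, mul_assoc, ← mul_assoc (ghost K e)]
      by_cases hef : e = f
      · subst hef
        rw [ghost_mul_edge_self]
        rcases vert_mul_path_eq_or (K := K) (E.r e) q y with h | h
        · rw [h]
          exact (ih q).imp_right <| Or.imp
            (fun ⟨r, hr, h⟩ => ⟨r, hr.trans (List.suffix_cons e q), h⟩)
            fun ⟨r, hr, h⟩ => ⟨r, hr.trans (List.suffix_cons e p), h⟩
        · exact .inl (by rw [h, mul_zero])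
      · exact .inl (by rw [ghost_mul_edge_of_ne hef, zero_mul, mul_zero])

variable (K) in
/-- The monomials `p q*`, for paths `p` and `q` with edges in `F` and common range in `W`. -/
def monomials (F : Set E.Edge) (W : Set E.Vertex) : Subsemigroup (LeavittPathAlgebra K E) where
  carrier := {a | a = 0 ∨ ∃ x ∈ W, ∃ p q, (∀ e ∈ p, e ∈ F) ∧ (∀ e ∈ q, e ∈ F) ∧
    a = path K p x * star (path K q x)}
  mul_mem' := by
    rintro _ _ (rfl | ⟨x, hx, p, q, hp, hq, rfl⟩) hb
    · exact .inl (zero_mul _)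
    obtain rfl | ⟨y, hy, p', q', hp', hq', rfl⟩ := hb
    · exact .inl (mul_zero _)
    rw [mul_assoc, ← mul_assoc (star _)]
    rcases star_path_mul_path_eq_or (K := K) q x p' y with h | ⟨r, hr, h⟩ | ⟨r, hr, h⟩
    · exact .inl (by rw [h, zero_mul, mul_zero])
    · rw [h, ← mul_assoc]
      rcases path_mul_path_eq_or (K := K) p x r y with h | h
      · refine .inr ⟨y, hy, p ++ r, q', ?_, hq', by rw [h]⟩
        exact List.forall_mem_append.mpr ⟨hp, fun e he => hp' e (hr.subset he)⟩
      · exact .inl (by rw [h, zero_mul])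
    · rw [h, ← star_mul]
      rcases path_mul_path_eq_or (K := K) q' y r x with h | h
      · refine .inr ⟨x, hx, p, q' ++ r, hp, ?_, by rw [h]⟩
        exact List.forall_mem_append.mpr ⟨hq', fun e he => hq e (hr.subset he)⟩
      · exact .inl (by rw [h, star_zero, mul_zero])

theorem path_mul_star_path_mem_monomials {F : Set E.Edge} {W : Set E.Vertex} (hx : x ∈ W)
    (hp : ∀ e ∈ p, e ∈ F) (hq : ∀ e ∈ q, e ∈ F) :
    path K p x * star (path K q x) ∈ monomials K F W :=
  .inr ⟨x, hx, p, q, hp, hq, rfl⟩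

theorem mk_single_mem_monomials (m : FreeSemigroup (LeavittGen E)) :
    (mk (MonoidAlgebra.single m 1) : LeavittPathAlgebra K E) ∈ monomials K Set.univ Set.univ := by
  have mem (x : E.Vertex) (p q : List E.Edge) :
      path K p x * star (path K q x) ∈ monomials K Set.univ Set.univ :=
    path_mul_star_path_mem_monomials trivial (fun _ _ => trivial) fun _ _ => trivial
  induction m using FreeSemigroup.recOnMul with
  | ih1 g =>
    change gen K g ∈ _
    cases g with
    | vertex x => simpa only [path_nil, star_vert, vert_mul_self] using mem x [] []
    | edge e =>
      simpa only [path_singleton, path_nil, star_vert, edge_mul_range] using mem (E.r e) [e] []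
    | ghost e =>
      simpa only [path_singleton, path_nil, star_edge, range_mul_ghost] using mem (E.r e) [] [e]
  | ih2 g m hg hm =>
    have := mul_mem hg hm
    rwa [← mk_mul, MonoidAlgebra.single_mul_single, one_mul] at this

theorem monomial_induction {P : LeavittPathAlgebra K E → Prop} (zero : P 0)
    (monomial : ∀ p q x, P (path K p x * star (path K q x)))
    (add : ∀ a b, P a → P b → P (a + b)) (smul : ∀ (k : K) a, P a → P (k • a))
    (a : LeavittPathAlgebra K E) : P a := by
  obtain ⟨a, rfl⟩ := mk_surjective a
  induction a using MonoidAlgebra.induction_linear with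
  | zero => exact zero
  | add a b ha hb => exact add _ _ ha hb
  | single m k =>
    rw [← mul_one k, ← smul_eq_mul, ← MonoidAlgebra.smul_single, mk_smul]
    refine smul k _ ?_
    obtain h | ⟨x, -, p, q, -, -, h⟩ := mk_single_mem_monomials (K := K) m
    · exact h ▸ zero
    · exact h ▸ monomial p q x

open Filter in
theorem eventually_mul_sum_vert (a : LeavittPathAlgebra K E) :
    ∀ᶠ T : Finset E.Vertex in atTop, a * ∑ x ∈ T, vert K x = a := by
  induction a using monomial_induction with
  | zero => simp
  | monomial p q x =>
    filter_upwards [eventually_ge_atTop {E.src q x}] with T hT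
    refine mul_sum_vert_of_mul_vert (x := E.src q x) ?_ (by simpa using hT)
    rw [mul_assoc, star_path_mul_src]
  | add a b ha hb =>
    filter_upwards [ha, hb] with T haT hbT
    rw [add_mul, haT, hbT]
  | smul k a ha =>
    filter_upwards [ha] with T haT
    rw [smul_mul_assoc, haT]

theorem exists_mul_vert_ne_zero {a : LeavittPathAlgebra K E} (ha : a ≠ 0) :
    ∃ x, a * vert K x ≠ 0 := by
  by_contra! h
  obtain ⟨T, hT⟩ := (eventually_mul_sum_vert a).exists
  exact ha (by rw [← hT, Finset.mul_sum, Finset.sum_eq_zero fun x _ => h x])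

theorem finite_monomials (hE : E.Acyclic) {F : Set E.Edge} {W : Set E.Vertex} (hF : F.Finite)
    (hW : W.Finite) : (monomials K F W : Set (LeavittPathAlgebra K E)).Finite := by
  have finite_paths (x : E.Vertex) := hE.finite_setOf_isPath hF x
  refine ((hW.biUnion fun x _ => (finite_paths x).image2
    (fun p q => path K p x * star (path K q x)) (finite_paths x)).insert 0).subset ?_
  rintro _ (rfl | ⟨x, hx, p, q, hp, hq, rfl⟩)
  · exact Set.mem_insert _ _
  by_cases hpx : E.IsPath p x
  · by_cases hqx : E.IsPath q x
    · exact .inr (Set.mem_biUnion hx ⟨p, ⟨hpx, hp⟩, q, ⟨hqx, hq⟩, rfl⟩)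
    · exact .inl (by rw [path_eq_zero hqx, star_zero, mul_zero])
  · exact .inl (by rw [path_eq_zero hpx, zero_mul])

open Filter in
theorem eventually_mem_span_monomials (a : LeavittPathAlgebra K E) :
    ∀ᶠ S : Finset E.Edge × Finset E.Vertex in atTop,
      a ∈ Submodule.span K (monomials K (S.1 : Set E.Edge) (S.2 : Set E.Vertex)) := by
  classical
  induction a using monomial_induction with
  | zero => exact .of_forall fun _ => zero_mem _
  | monomial p q x =>
    filter_upwards [eventually_ge_atTop ((p ++ q).toFinset, {x})] with S hS
    have mem_edges {e : E.Edge} (he : e ∈ p ++ q) : e ∈ S.1 := hS.1 (List.mem_toFinset.mpr he)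
    refine Submodule.subset_span (path_mul_star_path_mem_monomials
      (hS.2 (Finset.mem_singleton_self x)) ?_ ?_)
    · exact fun e he => mem_edges (List.mem_append_left q he)
    · exact fun e he => mem_edges (List.mem_append_right p he)
  | add a b ha hb => filter_upwards [ha, hb] with S using add_mem
  | smul k a ha => filter_upwards [ha] with S using Submodule.smul_mem _ k

theorem exists_finiteDimensional_mem (hE : E.Acyclic) (a : LeavittPathAlgebra K E) :
    ∃ A : NonUnitalSubalgebra K (LeavittPathAlgebra K E), FiniteDimensional K A ∧ a ∈ A := by
  classical
  obtain ⟨⟨F, W⟩, ha⟩ := (eventually_mem_span_monomials a).exists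
  let M := monomials K (F : Set E.Edge) (W : Set E.Vertex)
  have span_eq : (NonUnitalAlgebra.adjoin K (M : Set (LeavittPathAlgebra K E))).toSubmodule =
      Submodule.span K M := by
    rw [NonUnitalAlgebra.adjoin_eq_span, Subsemigroup.closure_eq]
  have finite_M : (M : Set (LeavittPathAlgebra K E)).Finite :=
    finite_monomials hE F.finite_toSet W.finite_toSet
  have finiteDimensional_span := FiniteDimensional.span_of_finite K finite_M
  rw [← span_eq] at ha finiteDimensional_span
  exact ⟨_, finiteDimensional_span, ha⟩

end Star

end LeavittPathAlgebra

namespace DirectedGraph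

/-- A maximal path, which is infinite or ends in a sink: the vertices it visits, each with the edge
through which the path leaves it. That edge is `none` at a sink, and what the two sequences do after
that carries no meaning. -/
@[ext]
structure MaximalPath (E : DirectedGraph.{u, v}) where
  vertex : ℕ → E.Vertex
  edge : ℕ → Option E.Edge
  source_edge : ∀ n, ∀ e ∈ edge n, E.s e = vertex n
  range_edge : ∀ n, ∀ e ∈ edge n, E.r e = vertex (n + 1)
  source_ne_of_eq_none : ∀ n, edge n = none → ∀ e, E.s e ≠ vertex n

namespace MaximalPath

variable {E : DirectedGraph.{u, v}} {e : E.Edge}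

/-- The path without its first edge. -/
def tail (y : E.MaximalPath) : E.MaximalPath where
  vertex n := y.vertex (n + 1)
  edge n := y.edge (n + 1)
  source_edge n := y.source_edge (n + 1)
  range_edge n := y.range_edge (n + 1)
  source_ne_of_eq_none n := y.source_ne_of_eq_none (n + 1)

/-- The path `y` preceded by the edge `e`. -/
def cons (e : E.Edge) (y : E.MaximalPath) (h : E.r e = y.vertex 0) : E.MaximalPath where
  vertex n := n.casesOn (E.s e) y.vertex
  edge n := n.casesOn (some e) y.edge
  source_edge
    | 0 => by simp
    | n + 1 => y.source_edge n
  range_edge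
    | 0 => by simpa using h
    | n + 1 => y.range_edge n
  source_ne_of_eq_none
    | 0 => by simp
    | n + 1 => y.source_ne_of_eq_none n

theorem cons_tail (y : E.MaximalPath) (h : y.edge 0 = some e) :
    y.tail.cons e (y.range_edge 0 e h) = y := by
  ext n : 2
  · cases n
    · exact y.source_edge 0 e h
    · rfl
  · cases n
    · exact h.symm
    · rfl

theorem exists_vertex_zero_eq (x : E.Vertex) : ∃ y : E.MaximalPath, y.vertex 0 = x := by
  have exists_next (x : E.Vertex) :
      ∃ o : Option E.Edge, (∀ e ∈ o, E.s e = x) ∧ (o = none → ∀ e, E.s e ≠ x) := by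
    by_cases h : ∃ e, E.s e = x
    · obtain ⟨e, he⟩ := h
      exact ⟨some e, by simpa using he, by simp⟩
    · exact ⟨none, by simp, fun _ => not_exists.mp h⟩
  choose next source_next sink_next using exists_next
  let vertex (n : ℕ) : E.Vertex := (fun x => (next x).elim x E.r)^[n] x
  refine ⟨⟨vertex, fun n => next (vertex n), fun n => source_next _, fun n e he => ?_,
    fun n => sink_next _⟩, rfl⟩
  rw [Option.mem_def] at he
  simp only [vertex, Function.iterate_succ_apply'] at he ⊢
  rw [he, Option.elim_some]

end MaximalPath

end DirectedGraph

namespace FreeLeavitt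

variable {K : Type w} [Field K] {E : DirectedGraph.{u, v}} {A : Type*}

/-- The extension to the free algebra of a choice of images of the generators. -/
noncomputable def lift [NonUnitalRing A] [Module K A] [IsScalarTower K A A] [SMulCommClass K A A]
    (φ : LeavittGen E → A) : FreeLeavitt K E →ₙₐ[K] A :=
  MonoidAlgebra.liftMagma K (FreeSemigroup.lift φ)

theorem lift_gen [NonUnitalRing A] [Module K A] [IsScalarTower K A A] [SMulCommClass K A A]
    (φ : LeavittGen E → A) (g : LeavittGen E) : lift φ (gen K E g) = φ g := by
  simp [lift, gen, MonoidAlgebra.liftMagma]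

theorem map_eq_map_of_con [NonUnitalNonAssocSemiring A] [DistribMulAction K A]
    {ψ : FreeLeavitt K E →ₙₐ[K] A} (hψ : ∀ a b, Rel K E a b → ψ a = ψ b) {a b : FreeLeavitt K E}
    (h : con K E a b) : ψ a = ψ b := by
  change RingConGen.Rel _ a b at h
  induction h with
  | of x y h =>
    obtain ⟨k, a, b, h, rfl, rfl⟩ := h
    rw [map_smul, map_smul, hψ a b h]
  | refl x => rfl
  | symm _ ih => exact ih.symm
  | trans _ _ ih₁ ih₂ => exact ih₁.trans ih₂
  | add _ _ ih₁ ih₂ => rw [map_add, map_add, ih₁, ih₂]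
  | mul _ _ ih₁ ih₂ => rw [map_mul, map_mul, ih₁, ih₂]

end FreeLeavitt

namespace DirectedGraph.MaximalPath

variable {K : Type w} [Field K] {E : DirectedGraph.{u, v}}

open Classical in
variable (K) in
/-- The representation of the generators of `L_K(E)` on functions of maximal paths: a vertex
restricts a function to the paths starting there, a ghost edge precomposes it with the addition of
that edge, and an edge precomposes it with the removal of that edge. -/
noncomputable def action : LeavittGen E → Module.End K (E.MaximalPath → K)
  | .vertex x =>
    { toFun φ y := if y.vertex 0 = x then φ y else 0
      map_add' φ χ := by ext y; simp only [Pi.add_apply]; split_ifs <;> simp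
      map_smul' k φ := by ext y; simp }
  | .edge e =>
    { toFun φ y := if y.edge 0 = some e then φ y.tail else 0
      map_add' φ χ := by ext y; simp only [Pi.add_apply]; split_ifs <;> simp
      map_smul' k φ := by ext y; simp }
  | .ghost e =>
    { toFun φ y := if h : E.r e = y.vertex 0 then φ (y.cons e h) else 0
      map_add' φ χ := by ext y; simp only [Pi.add_apply]; split_ifs <;> simp
      map_smul' k φ := by ext y; simp }

open Classical in
theorem action_vertex_apply (x : E.Vertex) (φ : E.MaximalPath → K) (y : E.MaximalPath) :
    action K (.vertex x) φ y = if y.vertex 0 = x then φ y else 0 := rfl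

open Classical in
theorem action_edge_apply (e : E.Edge) (φ : E.MaximalPath → K) (y : E.MaximalPath) :
    action K (.edge e) φ y = if y.edge 0 = some e then φ y.tail else 0 := rfl

open Classical in
theorem action_ghost_apply (e : E.Edge) (φ : E.MaximalPath → K) (y : E.MaximalPath) :
    action K (.ghost e) φ y = if h : E.r e = y.vertex 0 then φ (y.cons e h) else 0 := rfl

open Classical in
theorem action_edge_mul_ghost_apply (e : E.Edge) (φ : E.MaximalPath → K) (y : E.MaximalPath) :
    (action K (.edge e) * action K (.ghost e)) φ y =
      if y.edge 0 = some e then φ y else 0 := by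
  refine ite_congr rfl (fun h => ?_) fun _ => rfl
  exact (dif_pos (y.range_edge 0 e h)).trans (congrArg φ (y.cons_tail h))

theorem action_vertex_eq_sum {x : E.Vertex} (hfin : {e : E.Edge | E.s e = x}.Finite)
    (hne : {e : E.Edge | E.s e = x}.Nonempty) :
    action K (.vertex x) = ∑ e ∈ hfin.toFinset, action K (.edge e) * action K (.ghost e) := by
  classical
  ext1 φ
  ext1 y
  simp only [LinearMap.sum_apply, Finset.sum_apply, action_edge_mul_ghost_apply,
    action_vertex_apply]
  cases he : y.edge 0 with
  | none =>
    obtain ⟨e, rfl⟩ := hne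
    simp [(y.source_ne_of_eq_none 0 he e).symm]
  | some e => simp [y.source_edge 0 e he]

theorem lift_action_eq_of_rel {a b : FreeLeavitt K E} (h : FreeLeavitt.Rel K E a b) :
    FreeLeavitt.lift (action K) a = FreeLeavitt.lift (action K) b := by
  classical
  cases h <;> simp only [map_mul, map_sum, map_zero, FreeLeavitt.lift_gen]
  case vertex_eq_sum x hfin hne => exact action_vertex_eq_sum hfin hne
  all_goals
    ext φ y
    simp only [Module.End.mul_apply, action_vertex_apply, action_edge_apply, action_ghost_apply,
      LinearMap.zero_apply, Pi.zero_apply]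
  case vertex_mul_self => exact ite_eq_left_iff.mpr fun h => (if_neg h).symm
  case vertex_mul_of_ne h =>
    exact ite_eq_right_iff.mpr fun hx => if_neg fun hz => h (hx.symm.trans hz)
  case source_mul_edge e =>
    exact ite_eq_left_iff.mpr fun hs => (if_neg fun he => hs (y.source_edge 0 e he).symm).symm
  case edge_mul_range e =>
    exact ite_congr rfl (fun he => if_pos (y.range_edge 0 e he).symm) fun _ => rfl
  case range_mul_ghost => exact ite_eq_left_iff.mpr fun hr => by rw [dif_neg (mt Eq.symm hr)]
  case ghost_mul_source => exact dite_congr rfl (fun _ => if_pos rfl) fun _ => rfl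
  case ghost_mul_edge_self =>
    rw [eq_comm (a := y.vertex 0)]
    exact dite_congr rfl (fun _ => if_pos rfl) fun _ => rfl
  case ghost_mul_edge_of_ne h =>
    exact dite_eq_right_iff.mpr fun _ => if_neg fun hf => h (Option.some_injective _ hf)

end DirectedGraph.MaximalPath

namespace LeavittPathAlgebra

variable {K : Type w} [Field K] {E : DirectedGraph.{u, v}}

open DirectedGraph.MaximalPath in
theorem vert_ne_zero (x : E.Vertex) : vert K x ≠ 0 := by
  intro vert_eq_zero
  obtain ⟨y, hy⟩ := exists_vertex_zero_eq x
  have action_eq_zero : action K (.vertex x) = 0 := by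
    rw [← FreeLeavitt.lift_gen (K := K) (action K)]
    exact (FreeLeavitt.map_eq_map_of_con (fun _ _ => lift_action_eq_of_rel)
      (mk_eq_mk.mp vert_eq_zero)).trans (map_zero _)
  have one_eq_zero : action K (.vertex x) 1 y = 0 := by
    rw [action_eq_zero, LinearMap.zero_apply, Pi.zero_apply]
  rw [action_vertex_apply, if_pos hy] at one_eq_zero
  exact one_ne_zero one_eq_zero

theorem edge_ne_zero (e : E.Edge) : edge K e ≠ 0 := by
  intro h
  exact vert_ne_zero (K := K) (E.r e) (by rw [← ghost_mul_edge_self, h, mul_zero])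

variable {e : E.Edge} {x : E.Vertex} {p q : List E.Edge} {a : LeavittPathAlgebra K E}

theorem vert_mul_path_cons (hE : E.Acyclic) (h : E.IsPath (e :: p) x) :
    vert K x * path K (e :: p) x = 0 :=
  vert_mul_path_of_ne (hE.source_ne h).symm

variable (K) in
/-- The linear combinations of the paths with range `x`. -/
noncomputable def pathSpan (x : E.Vertex) : Submodule K (LeavittPathAlgebra K E) :=
  Submodule.span K (Set.range fun p : {p // E.IsPath p x} => path K p.1 x)

theorem path_mem_pathSpan (p : List E.Edge) (x : E.Vertex) : path K p x ∈ pathSpan K x := by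
  by_cases h : E.IsPath p x
  · exact Submodule.subset_span ⟨⟨p, h⟩, rfl⟩
  · exact path_eq_zero (K := K) h ▸ zero_mem _

theorem path_mul_vert_mem_pathSpan (p : List E.Edge) (x y : E.Vertex) :
    path K p y * vert K x ∈ pathSpan K x := by
  by_cases h : y = x
  · subst h
    exact (path_mul_vert (K := K) p y).symm ▸ path_mem_pathSpan p y
  · exact (path_mul_vert_of_ne (K := K) h).symm ▸ zero_mem _

theorem mul_vert_of_mem_pathSpan (ha : a ∈ pathSpan K x) : a * vert K x = a := by
  have eqOn : Set.EqOn (LinearMap.mulRight K (vert K x)) (LinearMap.id : _ →ₗ[K] _)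
      (Set.range fun p : {p // E.IsPath p x} => path K p.1 x) := by
    rintro _ ⟨p, rfl⟩
    exact path_mul_vert p.1 x
  exact LinearMap.eqOn_span eqOn ha

theorem mul_edge_eq_zero_of_mem_pathSpan (ha : a ∈ pathSpan K x) (h : x ≠ E.s e) :
    a * edge K e = 0 := by
  rw [← mul_vert_of_mem_pathSpan ha, mul_assoc, vert_mul_edge_of_ne h, mul_zero]

theorem mul_vert_eq_zero_of_finite (hfin : {e | E.s e = x}.Finite)
    (hne : {e | E.s e = x}.Nonempty) (ha : ∀ e, E.s e = x → a * edge K e = 0) :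
    a * vert K x = 0 := by
  rw [vert_eq_sum hfin hne, Finset.mul_sum]
  refine Finset.sum_eq_zero fun e he => ?_
  rw [← mul_assoc, ha e (hfin.mem_toFinset.mp he), zero_mul]

variable (K E) in
/-- The left ideal generated by the ghost edges, as a subspace. -/
noncomputable def ghostIdeal : Submodule K (LeavittPathAlgebra K E) :=
  Submodule.span K {a | ∃ b e, a = b * ghost K e}

open Filter in
theorem eventually_mul_sum_edge_mul_ghost (ha : a ∈ ghostIdeal K E) :
    ∀ᶠ F : Finset E.Edge in atTop, a * ∑ e ∈ F, edge K e * ghost K e = a := by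
  induction ha using Submodule.span_induction with
  | mem a ha =>
    obtain ⟨b, e, rfl⟩ := ha
    filter_upwards [eventually_ge_atTop {e}] with F hF
    rw [mul_assoc, Finset.mul_sum, Finset.sum_eq_single_of_mem e (by simpa using hF)]
    · rw [← mul_assoc (ghost K e), ghost_mul_edge_self, range_mul_ghost]
    · intro f _ hf
      rw [← mul_assoc, ghost_mul_edge_of_ne hf.symm, zero_mul]
  | zero => simp
  | add a b _ _ ha hb =>
    filter_upwards [ha, hb] with F haF hbF
    rw [add_mul, haF, hbF]
  | smul k a _ ha =>
    filter_upwards [ha] with F haF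
    rw [smul_mul_assoc, haF]

theorem eq_zero_of_forall_mul_edge_eq_zero (ha : a ∈ ghostIdeal K E)
    (h : ∀ e, a * edge K e = 0) : a = 0 := by
  classical
  obtain ⟨F, hF⟩ := (eventually_mul_sum_edge_mul_ghost ha).exists
  rw [← hF, Finset.mul_sum]
  exact Finset.sum_eq_zero fun e _ => by rw [← mul_assoc, h, zero_mul]

theorem finite_setOf_mul_edge_ne_zero (ha : a ∈ ghostIdeal K E) :
    {e | a * edge K e ≠ 0}.Finite := by
  classical
  obtain ⟨F, hF⟩ := (eventually_mul_sum_edge_mul_ghost ha).exists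
  refine F.finite_toSet.subset fun e he => ?_
  by_contra heF
  refine he ?_
  rw [← hF, mul_assoc, Finset.sum_mul, Finset.sum_eq_zero, mul_zero]
  intro f hf
  rw [mul_assoc, ghost_mul_edge_of_ne (ne_of_mem_of_not_mem hf heF), mul_zero]

section Star

variable [StarRing K]

theorem star_path_mul_path_self (h : E.IsPath p x) :
    star (path K p x) * path K p x = vert K x := by
  induction p with
  | nil => rw [path_nil, star_vert, vert_mul_self]
  | cons e p ih =>
    obtain ⟨he, hp⟩ := DirectedGraph.isPath_cons.mp h
    rw [star_path_cons, path_cons, mul_assoc, ← mul_assoc (ghost K e), ghost_mul_edge_self, he,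
      src_mul_path, ih hp]

theorem star_path_mul_path_of_ne (hE : E.Acyclic) (hp : E.IsPath p x) (hq : E.IsPath q x)
    (hpq : p ≠ q) : star (path K p x) * path K q x = 0 := by
  induction p generalizing q with
  | nil =>
    obtain ⟨f, q, rfl⟩ := List.exists_cons_of_ne_nil hpq.symm
    rw [path_nil, star_vert, vert_mul_path_cons hE hq]
  | cons e p ih =>
    cases q with
    | nil => rw [path_nil, ← star_vert, ← star_mul, vert_mul_path_cons hE hp, star_zero]
    | cons f q =>
      rw [star_path_cons, path_cons, mul_assoc, ← mul_assoc (ghost K e)]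
      by_cases hef : e = f
      · subst hef
        obtain ⟨-, hp⟩ := DirectedGraph.isPath_cons.mp hp
        obtain ⟨he, hq⟩ := DirectedGraph.isPath_cons.mp hq
        rw [ghost_mul_edge_self, he, src_mul_path, ih hp hq fun h => hpq (h ▸ rfl)]
      · rw [ghost_mul_edge_of_ne hef, zero_mul, mul_zero]

theorem isOrthonormalFamily_path (hE : E.Acyclic) (x : E.Vertex) :
    IsOrthonormalFamily (vert K x) fun p : {p // E.IsPath p x} => path K p.1 x :=
  ⟨fun p => star_path_mul_path_self p.2,
    fun p q hpq => star_path_mul_path_of_ne hE p.2 q.2 (Subtype.coe_ne_coe.mpr hpq)⟩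

theorem mul_vert_mem_pathSpan_sup_ghostIdeal (a : LeavittPathAlgebra K E) (x : E.Vertex) :
    a * vert K x ∈ pathSpan K x ⊔ ghostIdeal K E := by
  induction a using monomial_induction with
  | zero => exact zero_mul (vert K x) ▸ zero_mem _
  | monomial p q y =>
    cases q with
    | nil =>
      rw [path_nil, star_vert, path_mul_vert]
      exact Submodule.mem_sup_left (path_mul_vert_mem_pathSpan p x y)
    | cons e q =>
      refine Submodule.mem_sup_right ?_
      rw [mul_assoc]
      rcases star_path_mul_vert_eq_or (K := K) (e :: q) y x with h | h <;> rw [h]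
      · rw [star_path_cons, ← mul_assoc]
        exact Submodule.subset_span ⟨_, e, rfl⟩
      · rw [mul_zero]
        exact zero_mem _
  | add a b ha hb => exact add_mul a b (vert K x) ▸ add_mem ha hb
  | smul k a ha => exact smul_mul_assoc k a (vert K x) ▸ Submodule.smul_mem _ k ha

theorem eq_zero_of_mem_pathSpan_of_mul_edge_eq_zero (hE : E.Acyclic)
    (ha : a ∈ pathSpan K (E.s e)) (hae : a * edge K e = 0) : a = 0 := by
  refine (isOrthonormalFamily_path hE (E.s e)).eq_zero_of_mul_eq_zero ha ?_ hae
  rw [source_mul_edge]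
  exact edge_ne_zero e

/-- At an infinite emitter `x`, where (CK2) is not available, the component of `a x` in the ghost
ideal vanishes on all but finitely many edges leaving `x`, so one of these edges annihilates the
component in the span of the paths. -/
theorem mul_vert_mem_pathSpan (hE : E.Acyclic) (ha : ∀ e, a * edge K e = 0) (x : E.Vertex) :
    a * vert K x ∈ pathSpan K x := by
  obtain ⟨l, hl, g, hg, hlg⟩ :=
    Submodule.mem_sup.mp (mul_vert_mem_pathSpan_sup_ghostIdeal a x)
  have add_mul_edge (e : E.Edge) : l * edge K e + g * edge K e = 0 := by
    rw [← add_mul, hlg, mul_assoc]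
    by_cases h : x = E.s e
    · rw [h, source_mul_edge, ha]
    · rw [vert_mul_edge_of_ne h, mul_zero]
  have mem_of_mul_edge_eq_zero (h : ∀ e, l * edge K e = 0) : a * vert K x ∈ pathSpan K x := by
    have g_eq_zero : g = 0 := eq_zero_of_forall_mul_edge_eq_zero hg fun e => by
      simpa only [h, zero_add] using add_mul_edge e
    rwa [← hlg, g_eq_zero, add_zero]
  rcases {e | E.s e = x}.eq_empty_or_nonempty with hempty | hne
  · exact mem_of_mul_edge_eq_zero fun e =>
      mul_edge_eq_zero_of_mem_pathSpan hl fun h => Set.eq_empty_iff_forall_notMem.mp hempty e h.symm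
  by_cases hfin : {e | E.s e = x}.Finite
  · rw [mul_vert_eq_zero_of_finite hfin hne fun e _ => ha e]
    exact zero_mem _
  · obtain ⟨e, rfl, hge⟩ := (Set.Infinite.sdiff hfin (finite_setOf_mul_edge_ne_zero hg)).nonempty
    have l_eq_zero : l = 0 := eq_zero_of_mem_pathSpan_of_mul_edge_eq_zero hE hl <| by
      simpa only [not_not.mp hge, add_zero] using add_mul_edge e
    exact mem_of_mul_edge_eq_zero fun f => by rw [l_eq_zero, zero_mul]

variable (K E) in
/-- The span of the monomials `p q*` with a path `q` of length at most `n`. -/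
noncomputable def ghostFiltration (n : ℕ) : Submodule K (LeavittPathAlgebra K E) :=
  Submodule.span K {a | ∃ p q x, q.length ≤ n ∧ a = path K p x * star (path K q x)}

theorem path_mul_star_path_mem_ghostFiltration {n : ℕ} (hq : q.length ≤ n) :
    path K p x * star (path K q x) ∈ ghostFiltration K E n :=
  Submodule.subset_span ⟨p, q, x, hq, rfl⟩

open Filter in
theorem eventually_mem_ghostFiltration (a : LeavittPathAlgebra K E) :
    ∀ᶠ n in atTop, a ∈ ghostFiltration K E n := by
  induction a using monomial_induction with
  | zero => exact .of_forall fun _ => zero_mem _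
  | monomial p q x =>
    filter_upwards [eventually_ge_atTop q.length] with n hn
    exact path_mul_star_path_mem_ghostFiltration hn
  | add a b ha hb => filter_upwards [ha, hb] with n using add_mem
  | smul k a ha => filter_upwards [ha] with n using Submodule.smul_mem _ k

theorem mul_vert_mem_pathSpan_of_mem_ghostFiltration (ha : a ∈ ghostFiltration K E 0)
    (x : E.Vertex) : a * vert K x ∈ pathSpan K x := by
  suffices ghostFiltration K E 0 ≤ (pathSpan K x).comap (LinearMap.mulRight K (vert K x)) from
    this ha
  refine Submodule.span_le.mpr ?_
  rintro _ ⟨p, q, y, hq, rfl⟩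
  obtain rfl := List.eq_nil_of_length_eq_zero (Nat.le_zero.mp hq)
  change path K p y * star (vert K y) * vert K x ∈ pathSpan K x
  rw [star_vert, path_mul_vert]
  exact path_mul_vert_mem_pathSpan p x y

theorem mul_edge_mem_ghostFiltration {n : ℕ} (ha : a ∈ ghostFiltration K E (n + 1)) (e : E.Edge) :
    a * edge K e ∈ ghostFiltration K E n := by
  suffices ghostFiltration K E (n + 1) ≤
      (ghostFiltration K E n).comap (LinearMap.mulRight K (edge K e)) from this ha
  refine Submodule.span_le.mpr ?_
  rintro _ ⟨p, q, x, hq, rfl⟩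
  change path K p x * star (path K q x) * edge K e ∈ ghostFiltration K E n
  cases q with
  | nil =>
    rw [path_nil, star_vert, path_mul_vert, ← path_singleton]
    rcases path_mul_path_eq_or (K := K) p x [e] (E.r e) with h | h <;> rw [h]
    · rw [← path_mul_vert, ← star_vert]
      exact path_mul_star_path_mem_ghostFiltration (q := []) n.zero_le
    · exact zero_mem _
  | cons f q =>
    rw [star_path_cons, mul_assoc, mul_assoc]
    by_cases hf : f = e
    · subst hf
      rw [ghost_mul_edge_self]
      rcases star_path_mul_vert_eq_or (K := K) q x (E.r f) with h | h <;> rw [h]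
      · exact path_mul_star_path_mem_ghostFiltration (Nat.le_of_succ_le_succ hq)
      · rw [mul_zero]
        exact zero_mem _
    · rw [ghost_mul_edge_of_ne hf, mul_zero, mul_zero]
      exact zero_mem _

theorem eq_zero_of_star_mul_self_eq_zero_of_mem_pathSpan (hK : IsPosDefInvolution K)
    (hE : E.Acyclic) (ha : star a * a = 0) (hpath : ∀ x, a * vert K x ∈ pathSpan K x) : a = 0 := by
  by_contra hne
  obtain ⟨x, hx⟩ := exists_mul_vert_ne_zero hne
  refine hx ((isOrthonormalFamily_path hE x).eq_zero_of_star_mul_self_eq_zero hK (vert_ne_zero x)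
    (hpath x) ?_)
  exact star_mul_mul_mul_eq_zero ha _

theorem isNProper_one (hK : IsPosDefInvolution K) (hE : E.Acyclic) :
    IsNProper (LeavittPathAlgebra K E) 1 := by
  refine isNProper_one_iff.mpr fun a ha => ?_
  obtain ⟨n, hn⟩ := (eventually_mem_ghostFiltration a).exists
  induction n generalizing a with
  | zero =>
    exact eq_zero_of_star_mul_self_eq_zero_of_mem_pathSpan hK hE ha
      (mul_vert_mem_pathSpan_of_mem_ghostFiltration hn)
  | succ n ih =>
    have mul_edge_eq_zero (e : E.Edge) : a * edge K e = 0 :=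
      ih _ (star_mul_mul_mul_eq_zero ha _) (mul_edge_mem_ghostFiltration hn e)
    exact eq_zero_of_star_mul_self_eq_zero_of_mem_pathSpan hK hE ha
      (mul_vert_mem_pathSpan hE mul_edge_eq_zero)

theorem isStarRegular (hK : IsPosDefInvolution K) (hE : E.Acyclic) :
    IsStarRegular (LeavittPathAlgebra K E) :=
  (isNProper_one hK hE).isStarRegular_of_locallyFinite (exists_finiteDimensional_mem (K := K) hE)

theorem isOrthonormalFamily_edge {ι : Type*} {u : ι → E.Edge} (hu : u.Injective)
    (hr : ∀ i, E.r (u i) = x) : IsOrthonormalFamily (vert K x) fun i => edge K (u i) := by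
  refine ⟨fun i => ?_, fun i j hij => ?_⟩
  · rw [star_edge, ghost_mul_edge_self, hr]
  · simp only [star_edge, ghost_mul_edge_of_ne (hu.ne hij)]

theorem isNProper_of_isStarRegular (h : IsStarRegular (LeavittPathAlgebra K E)) {n : ℕ}
    {u : Fin n → E.Edge} (hu : u.Injective) (hr : ∀ i, E.r (u i) = x) : IsNProper K n := by
  classical
  refine (isOrthonormalFamily_edge (K := K) hu hr).isNProper (vert_ne_zero x)
    (h.isNProper_one fun a => ?_)
  obtain ⟨T, hT⟩ := (eventually_mul_sum_vert a).exists
  exact ⟨_, hT⟩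

end Star

end LeavittPathAlgebra

namespace DirectedGraph

/-- The graph with two vertices and `n` edges from the first one (`false`) to the second one
(`true`). -/
def parallelEdges (n : ℕ) : DirectedGraph.{u, v} where
  Vertex := ULift Bool
  Edge := ULift (Fin n)
  s _ := ⟨false⟩
  r _ := ⟨true⟩

theorem acyclic_parallelEdges (n : ℕ) : (parallelEdges.{u, v} n).Acyclic := by
  rintro p ⟨-, ⟨_, range_eq_source⟩, -⟩
  simp [parallelEdges] at range_eq_source

end DirectedGraph

theorem corollary3p4 (K : Type w) [Field K] [StarRing K] :
    IsPosDefInvolution K ↔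
      ∀ E : DirectedGraph.{u, v}, E.Acyclic → IsStarRegular (LeavittPathAlgebra K E) := by
  refine ⟨fun hK E hE => LeavittPathAlgebra.isStarRegular hK hE, fun h n _ => ?_⟩
  exact LeavittPathAlgebra.isNProper_of_isStarRegular
    (h _ (DirectedGraph.acyclic_parallelEdges n)) ULift.up_injective fun _ => rfl
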